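/- Let $\mathbb K=\mathbb R$ or $\mathbb C$ ("holomorphic" means $\mathbb K$-analytic), let $0\le s\le m\le n$, and let $\Pi^{s+n}\subset\mathbb K^{s+n}$ be a domain (nonempty, open, connected). Write ${}^st=(t_1,\dots,t_s)$ for $t\in\mathbb K^m$. Let $X=\|X_{ij}\|$ be an $n\times m$ matrix of holomorphic functions $X_{ij}\colon\Pi^{s+n}\to\mathbb K$, and consider the $s$-nonautonomous total differential system $$dx = X({}^st,x)\,dt,\qquad t\in\mathbb K^m,\ x\in\mathbb K^n,\ ({}^st,x)\in\Pi^{s+n}.$$ Suppose that it is completely solvable: for all $(t_0,x_0)$ with $({}^st_0,x_0)\in\Pi^{s+n}$ the Cauchy problem $x(t_0)=x_0$ has a solution near $t_0$, and any two such solutions coincide near $t_0$. Let ${}^sX$ be the matrix obtained from $X$ by deleting its first $s$ columns, and suppose that $\operatorname{rank}{}^sX({}^st,x)=r$ at every point of $\Pi^{s+n}$. An $s$-nonautonomous first integral on an open set $U\subset\Pi^{s+n}$ is a holomorphic function $F\colon U\to\mathbb K$ of $({}^st,x)$ such that, for $j=1,\dots,m$, $\ \partial_{t_j}F+\sum_{i=1}^nX_{ij}\,\partial_{x_i}F=0$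 on $U$ (where $\partial_{t_j}F=0$ for $j>s$). Functions $F_1,\dots,F_k$ are functionally independent on $U$ if their Jacobi matrix with respect to $({}^st,x)$ has rank $k$ at all points of $U$ outside a set of measure zero. Then $r\le n$ and the system has locally exactly $n-r$ functionally independent $s$-nonautonomous first integrals: 1. every point of $\Pi^{s+n}$ has a neighbourhood $U\subset\Pi^{s+n}$, itself a domain, on which there are $n-r$ functionally independent $s$-nonautonomous first integrals $F_1,\dots,F_{n-r}\colon U\to\mathbb K$, whose Jacobi matrix moreover has rank $n-r$ at every point of $U$; 2. on no nonempty open subset $V\subset\Pi^{s+n}$ (in particular not on $\Pi^{s+n}$ itself) are there more than $n-r$ functionally independent $s$-nonautonomous first integrals. -/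

import Mathlib

open MeasureTheory Topology

namespace TotalDifferential

variable {𝕜 : Type*} [RCLike 𝕜] {s m n : ℕ}

/-- `x` is a solution on `T` of the total differential system `dx = X(t, x) dt` given on `P`: its
graph over `T` stays in `P`, and at each `t ∈ T` its differential is the linear map
`dt ↦ X(t, x t) dt`. -/
def IsSolutionOn (X : (Fin m → 𝕜) × (Fin n → 𝕜) → Matrix (Fin n) (Fin m) 𝕜)
    (P : Set ((Fin m → 𝕜) × (Fin n → 𝕜))) (T : Set (Fin m → 𝕜))
    (x : (Fin m → 𝕜) → (Fin n → 𝕜)) : Prop :=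
  ∀ t ∈ T, (t, x t) ∈ P ∧
    HasFDerivAt x (LinearMap.toContinuousLinearMap (X (t, x t)).mulVecLin) t

/-- The system `dx = X(t, x) dt` is completely solvable on `P`: for every `(t₀, x₀) ∈ P` the Cauchy
problem `x(t₀) = x₀` has a solution on some open neighbourhood of `t₀`, and any two solutions of it
coincide near `t₀`. -/
def CompletelySolvableOn (X : (Fin m → 𝕜) × (Fin n → 𝕜) → Matrix (Fin n) (Fin m) 𝕜)
    (P : Set ((Fin m → 𝕜) × (Fin n → 𝕜))) : Prop :=
  ∀ t₀ x₀, (t₀, x₀) ∈ P →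
    (∃ T x, IsOpen T ∧ t₀ ∈ T ∧ IsSolutionOn X P T x ∧ x t₀ = x₀) ∧
    (∀ T x y, IsOpen T → t₀ ∈ T → IsSolutionOn X P T x → IsSolutionOn X P T y →
      x t₀ = x₀ → y t₀ = x₀ → x =ᶠ[𝓝 t₀] y)

/-- The operator `𝔛ⱼ = ∂/∂tⱼ + ∑ᵢ Xᵢⱼ(t, x) ∂/∂xᵢ` applied to `F` at the point `p = (t, x)`. -/
noncomputable def operator (X : (Fin m → 𝕜) × (Fin n → 𝕜) → Matrix (Fin n) (Fin m) 𝕜)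
    (j : Fin m) (F : (Fin m → 𝕜) × (Fin n → 𝕜) → 𝕜) (p : (Fin m → 𝕜) × (Fin n → 𝕜)) : 𝕜 :=
  fderiv 𝕜 F p (Pi.single j 1, 0) + ∑ i, X p i j * fderiv 𝕜 F p (0, Pi.single i 1)

/-- `F` is a (holomorphic, i.e. `𝕜`-analytic) first integral on `P` of `dx = X(t, x) dt`. -/
def IsFirstIntegralOn (X : (Fin m → 𝕜) × (Fin n → 𝕜) → Matrix (Fin n) (Fin m) 𝕜)
    (P : Set ((Fin m → 𝕜) × (Fin n → 𝕜))) (F : (Fin m → 𝕜) × (Fin n → 𝕜) → 𝕜) : Prop :=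
  AnalyticOnNhd 𝕜 F P ∧ ∀ p ∈ P, ∀ j, operator X j F p = 0

/-- The projection `(t, x) ↦ (ˢt, x)`, where `ˢt = (t₁, …, tₛ)`. -/
def proj (hs : s ≤ m) (p : (Fin m → 𝕜) × (Fin n → 𝕜)) : (Fin s → 𝕜) × (Fin n → 𝕜) :=
  (fun j => p.1 (Fin.castLE hs j), p.2)

/-- The matrix `ˢX`: delete the first `s` columns. -/
def deleteColumns (s : ℕ) (A : Matrix (Fin n) (Fin m) 𝕜) :
    Matrix (Fin n) {j : Fin m // s ≤ j.val} 𝕜 :=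
  A.submatrix id Subtype.val

/-- `F`, a function of `(ˢt, x)`, is an `s`-nonautonomous first integral on `U` of the
`s`-nonautonomous system `dx = X(ˢt, x) dt`: regarded as a function of `(t, x)` it is a first
integral of that system on `{(t, x) | (ˢt, x) ∈ U}`. -/
def IsNonautonomousFirstIntegralOn (hs : s ≤ m)
    (X : (Fin s → 𝕜) × (Fin n → 𝕜) → Matrix (Fin n) (Fin m) 𝕜)
    (U : Set ((Fin s → 𝕜) × (Fin n → 𝕜))) (F : (Fin s → 𝕜) × (Fin n → 𝕜) → 𝕜) : Prop :=
  IsFirstIntegralOn (fun p => X (proj hs p)) (proj hs ⁻¹' U) (fun p => F (proj hs p))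

/-- The Jacobi matrix of the functions `F₁, …, F_k` of `(ˢt, x)` at `q`. -/
noncomputable def jacobi {k : ℕ} (F : Fin k → (Fin s → 𝕜) × (Fin n → 𝕜) → 𝕜)
    (q : (Fin s → 𝕜) × (Fin n → 𝕜)) : Matrix (Fin k) (Fin s ⊕ Fin n) 𝕜 :=
  Matrix.of fun l => Sum.elim (fun j => fderiv 𝕜 (F l) q (Pi.single j 1, 0))
    (fun i => fderiv 𝕜 (F l) q (0, Pi.single i 1))

/-- `F₁, …, F_k` are functionally independent on `U`: their Jacobi matrix has rank `k` on `U`,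
except perhaps on a set of Lebesgue measure zero. -/
def FunctionallyIndependentOn {k : ℕ} (U : Set ((Fin s → 𝕜) × (Fin n → 𝕜)))
    (F : Fin k → (Fin s → 𝕜) × (Fin n → 𝕜) → 𝕜) : Prop :=
  ∀ᵐ q ∂(Measure.addHaar : Measure ((Fin s → 𝕜) × (Fin n → 𝕜))), q ∈ U → (jacobi F q).rank = k

end TotalDifferential

/-!
Write `Y q dt = (ˢdt, X(q) dt)`. A function `F` of `(ˢt, x)` is a first integral exactly when
`DF(q) ∘ Y(q) = 0` (`isNonautonomousFirstIntegralOn_iff`), and `Y(q)` has rank `s + r`, so the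
differentials of first integrals lie at each point in a space of dimension `n - r`
(`rank_jacobi_add_le`). This gives the upper bound: a nonempty open set has positive measure, hence
contains a point where the Jacobi matrix has full rank.

For the existence, a solution `x` of the system yields an integral manifold `c(t) = (ˢt, x(t))` with
`Dc = Y ∘ c`, and the symmetry of `D²c` says that the vector fields `q ↦ Y(q) a` commute
(`fderiv_field_comm`). Commuting analytic vector fields, linearly independent at a point, can be
straightened analytically (`exists_analyticAt_submersion`): let `ψ(v, w)` be the time-one value of
the solution of `x' = Y(x) v` starting at `x₀ + ι w`, with `ι` parametrising a complement of the
range of `Y(x₀)`. Commutation gives `∂ψ/∂v (a) = Y(ψ) a`, and the `w`-component of the inverse of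
`ψ` is constant along the fields.

The analytic dependence of `ψ` on `(v, w)`, over `ℝ` and `ℂ` at once, comes from the implicit
function theorem in the Banach space `C([0, 1], E)`, applied to the integral form of the
differential equation (`exists_analyticAt_solution_integral_equation`); time stays real even when
the scalars are complex. The superposition operator `h ↦ f ∘ h` is analytic there because the power
series of `f` can be applied pointwise (`exists_analyticAt_superposition`). Both
the derivative of the solution curve `x` in the direction `a` of `v` and `σ ↦ σ Y(x(σ)) a` solve the
linearised integral equation (`smul_eq_primitive_of_commute`), which is a contraction for small
parameters, so they agree; at `σ = 1` this is the formula for `∂ψ/∂v (a)`.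
-/

namespace TotalDifferential

open scoped ContDiff
open Filter Set

/-! ### Superposition operators on spaces of continuous functions -/

section Nemytskii

lemma update_apply_eq {ι K E : Type*} [DecidableEq ι] [TopologicalSpace K] [TopologicalSpace E]
    (h : ι → C(K, E)) (i : ι) (c : C(K, E)) (σ : K) :
    (fun j => Function.update h i c j σ) = Function.update (fun j => h j σ) i (c σ) := by
  ext j
  by_cases hj : j = i
  · subst hj; simp
  · simp [hj]

variable {𝕜 K E G : Type*} [RCLike 𝕜] [TopologicalSpace K] [CompactSpace K]
  [NormedAddCommGroup E] [NormedSpace 𝕜 E] [NormedAddCommGroup G] [NormedSpace 𝕜 G]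

/-- A continuous multilinear map applied pointwise to continuous functions on a compact space. -/
noncomputable def pointwiseMultilinear (K : Type*) [TopologicalSpace K] [CompactSpace K] {k : ℕ}
    (p : ContinuousMultilinearMap 𝕜 (fun _ : Fin k => E) G) :
    ContinuousMultilinearMap 𝕜 (fun _ : Fin k => C(K, E)) C(K, G) :=
  MultilinearMap.mkContinuous
    { toFun := fun h => ⟨fun σ => p fun i => h i σ, by fun_prop⟩
      map_update_add' := by
        intro _ h i a b
        ext σ
        simp [update_apply_eq]
      map_update_smul' := by
        intro _ h i c a
        ext σ
        simp [update_apply_eq] }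
    ‖p‖ (by
      intro h
      refine (ContinuousMap.norm_le _ (by positivity)).2 fun σ => ?_
      refine (p.le_opNorm _).trans ?_
      gcongr with i
      exact (h i).norm_coe_le_norm σ)

@[simp]
lemma pointwiseMultilinear_apply {k : ℕ}
    (p : ContinuousMultilinearMap 𝕜 (fun _ : Fin k => E) G) (h : Fin k → C(K, E)) (σ : K) :
    pointwiseMultilinear K p h σ = p fun i => h i σ := rfl

lemma norm_pointwiseMultilinear_le {k : ℕ}
    (p : ContinuousMultilinearMap 𝕜 (fun _ : Fin k => E) G) :
    ‖pointwiseMultilinear K p‖ ≤ ‖p‖ :=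
  MultilinearMap.mkContinuous_norm_le _ (norm_nonneg _) _

/-- The superposition operator `h ↦ f (x₀ + h ·)` of a function analytic at `x₀` is analytic on
continuous functions: its power series is that of `f`, applied pointwise. -/
theorem exists_analyticAt_superposition [CompleteSpace G] {f : E → G} {x₀ : E}
    (hf : AnalyticAt 𝕜 f x₀) (K : Type*) [TopologicalSpace K] [CompactSpace K] :
    ∃ N : C(K, E) → C(K, G), AnalyticAt 𝕜 N 0 ∧
      ∀ᶠ h in 𝓝 (0 : C(K, E)), ∀ σ, N h σ = f (x₀ + h σ) := by
  obtain ⟨p, R, hp⟩ := hf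
  let P : FormalMultilinearSeries 𝕜 C(K, E) C(K, G) := fun k => pointwiseMultilinear K (p k)
  have hR : p.radius ≤ P.radius := by
    refine ENNReal.le_of_forall_nnreal_lt fun r hr => ?_
    obtain ⟨C, -, hC⟩ := p.norm_mul_pow_le_of_lt_radius hr
    refine P.le_radius_of_bound C fun k => le_trans ?_ (hC k)
    gcongr
    exact norm_pointwiseMultilinear_le _
  have hP := P.hasFPowerSeriesOnBall ((hp.r_pos.trans_le hp.r_le).trans_le hR)
  refine ⟨P.sum, hP.analyticAt, ?_⟩
  filter_upwards [Metric.eball_mem_nhds (0 : C(K, E)) hp.r_pos] with h hh σ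
  have h1 := hP.hasSum (Metric.eball_subset_eball (hp.r_le.trans hR) hh)
  have h2 := (ContinuousMap.evalCLM 𝕜 (M := G) σ).hasSum h1
  have hσ : h σ ∈ Metric.eball (0 : E) R := by
    simp only [Metric.mem_eball, edist_zero_right] at hh ⊢
    refine lt_of_le_of_lt ?_ hh
    rw [enorm_le_iff_norm_le]
    exact h.norm_coe_le_norm σ
  have h3 := hp.hasSum hσ
  simpa [P] using h2.unique h3

/-- The derivative of a superposition operator is computed pointwise. -/
lemma fderiv_superposition {f : E → G} {x₀ : E} {N : C(K, E) → C(K, G)} {h : C(K, E)}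
    (hN : DifferentiableAt 𝕜 N h) (hNf : ∀ᶠ h in 𝓝 h, ∀ σ, N h σ = f (x₀ + h σ)) (σ : K)
    (hf : DifferentiableAt 𝕜 f (x₀ + h σ)) (k : C(K, E)) :
    fderiv 𝕜 N h k σ = fderiv 𝕜 f (x₀ + h σ) (k σ) := by
  have h1 := (ContinuousMap.evalCLM 𝕜 (M := G) σ).hasFDerivAt.comp h hN.hasFDerivAt
  have h2 : HasFDerivAt (fun h : C(K, E) => x₀ + h σ) (ContinuousMap.evalCLM 𝕜 (M := E) σ) h :=
    (ContinuousMap.evalCLM 𝕜 (M := E) σ).hasFDerivAt.const_add x₀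
  have h3 := hf.hasFDerivAt.comp h h2
  have h4 := h1.congr_of_eventuallyEq (f₁ := f ∘ fun h : C(K, E) => x₀ + h σ) <| by
    filter_upwards [hNf] with h hh
    simp [hh σ]
  exact congrArg (fun L => L k) (h4.unique h3)

end Nemytskii

/-! ### The primitive of a continuous curve -/

section Primitive

variable {𝕜 E : Type*} [RCLike 𝕜] [NormedAddCommGroup E] [NormedSpace 𝕜 E] [NormedSpace ℝ E]
  [SMulCommClass ℝ 𝕜 E]

/-- The primitive vanishing at `0`, as a continuous linear operator on `C([0, 1], E)`. It is linear
over `𝕜` although the variable of integration is real; `IccExtend` makes the integrand a function on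
`ℝ`. -/
noncomputable def primitive (𝕜 : Type*) {E : Type*} [RCLike 𝕜] [NormedAddCommGroup E]
    [NormedSpace 𝕜 E] [NormedSpace ℝ E] [SMulCommClass ℝ 𝕜 E] :
    C(unitInterval, E) →L[𝕜] C(unitInterval, E) :=
  LinearMap.mkContinuous
    { toFun := fun g => ⟨fun σ => ∫ τ in (0 : ℝ)..σ, IccExtend zero_le_one g τ,
        (intervalIntegral.continuous_primitive
          (fun _ _ => (g.continuous.Icc_extend' (h := zero_le_one)).intervalIntegrable _ _) 0).comp
            continuous_subtype_val⟩
      map_add' := by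
        intro g k
        ext σ
        exact intervalIntegral.integral_add
          ((g.continuous.Icc_extend' (h := zero_le_one)).intervalIntegrable _ _)
          ((k.continuous.Icc_extend' (h := zero_le_one)).intervalIntegrable _ _)
      map_smul' := by
        intro c g
        ext σ
        exact intervalIntegral.integral_smul c _ }
    1 (by
      intro g
      refine (ContinuousMap.norm_le _ (by positivity)).2 fun σ => ?_
      have h1 : ∀ τ ∈ uIoc (0 : ℝ) σ, ‖IccExtend zero_le_one g τ‖ ≤ ‖g‖ :=
        fun τ _ => g.norm_coe_le_norm _
      refine (intervalIntegral.norm_integral_le_of_norm_le_const h1).trans ?_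
      rw [one_mul, sub_zero, abs_of_nonneg σ.2.1]
      exact mul_le_of_le_one_right (norm_nonneg g) σ.2.2)

lemma primitive_apply (g : C(unitInterval, E)) (σ : unitInterval) :
    primitive 𝕜 g σ = ∫ τ in (0 : ℝ)..σ, IccExtend zero_le_one g τ := rfl

variable [CompleteSpace E]

lemma eq_primitive {g ζ : C(unitInterval, E)} {z : ℝ → E} (h0 : z 0 = 0)
    (hz : ∀ σ : unitInterval, ζ σ = z σ) (hd : ∀ σ : unitInterval, HasDerivAt z (g σ) σ) :
    ζ = primitive 𝕜 g := by
  ext σ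
  rw [primitive_apply, intervalIntegral.integral_eq_sub_of_hasDerivAt (f := z) _
    ((g.continuous.Icc_extend' (h := zero_le_one)).intervalIntegrable _ _), h0, hz, sub_zero]
  intro τ hτ
  rw [uIcc_of_le σ.2.1] at hτ
  have hτ' : τ ∈ Icc (0 : ℝ) 1 := ⟨hτ.1, hτ.2.trans σ.2.2⟩
  rw [IccExtend_of_mem _ _ hτ']
  exact hd ⟨τ, hτ'⟩

end Primitive

/-! ### Analytic dependence of solutions on parameters -/

section Flow

variable {𝕜 V W E : Type*} [RCLike 𝕜] [NormedAddCommGroup V] [NormedSpace 𝕜 V]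
  [NormedAddCommGroup W] [NormedSpace 𝕜 W] [NormedAddCommGroup E] [NormedSpace 𝕜 E]

/-- The map sending a vector `v` and a curve `h` to the curve `σ ↦ (v, h σ)`. -/
noncomputable def prodConst (𝕜 V E : Type*) [RCLike 𝕜] [NormedAddCommGroup V] [NormedSpace 𝕜 V]
    [NormedAddCommGroup E] [NormedSpace 𝕜 E] :
    V × C(unitInterval, E) →L[𝕜] C(unitInterval, V × E) :=
  LinearMap.mkContinuous
    { toFun := fun q => ⟨fun σ => (q.1, q.2 σ), by fun_prop⟩
      map_add' := fun _ _ => rfl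
      map_smul' := fun _ _ => rfl }
    1 (by
      intro q
      refine (ContinuousMap.norm_le _ (by positivity)).2 fun σ => ?_
      rw [one_mul]
      exact max_le_max le_rfl (q.2.norm_coe_le_norm σ))

@[simp]
lemma prodConst_apply (q : V × C(unitInterval, E)) (σ : unitInterval) :
    prodConst 𝕜 V E q σ = (q.1, q.2 σ) := rfl

/-- The constant curves, as a continuous linear map. -/
noncomputable def constCurve (𝕜 E : Type*) [RCLike 𝕜] [NormedAddCommGroup E] [NormedSpace 𝕜 E] :
    E →L[𝕜] C(unitInterval, E) :=
  LinearMap.mkContinuous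
    { toFun := fun x => ContinuousMap.const _ x
      map_add' := fun _ _ => rfl
      map_smul' := fun _ _ => rfl }
    1 (by
      intro x
      refine (ContinuousMap.norm_le _ (by positivity)).2 fun σ => ?_
      rw [one_mul]
      exact le_rfl)

@[simp]
lemma constCurve_apply (x : E) (σ : unitInterval) : constCurve 𝕜 E x σ = x := rfl

lemma fderiv_comp_prodConst_zero {N : C(unitInterval, V × E) → C(unitInterval, E)}
    (hN : AnalyticAt 𝕜 N 0)
    (hN0 : ∀ᶠ k in 𝓝 (0 : C(unitInterval, E)), N (prodConst 𝕜 V E (0, k)) = 0) :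
    fderiv 𝕜 N 0 ∘L (prodConst 𝕜 V E ∘L .inr 𝕜 V C(unitInterval, E)) = 0 := by
  let J : C(unitInterval, E) →L[𝕜] C(unitInterval, V × E) :=
    prodConst 𝕜 V E ∘L ContinuousLinearMap.inr 𝕜 V C(unitInterval, E)
  have h1 : HasFDerivAt (fun k => N (J k)) (fderiv 𝕜 N 0 ∘L J) 0 := by
    have h2 : HasFDerivAt N (fderiv 𝕜 N 0) (J 0) := by
      rw [map_zero]; exact hN.differentiableAt.hasFDerivAt
    exact h2.comp 0 J.hasFDerivAt
  have h3 : (fun k => N (J k)) =ᶠ[𝓝 0] fun _ => 0 := hN0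
  exact h1.unique ((hasFDerivAt_const _ _).congr_of_eventuallyEq h3)

variable [NormedSpace ℝ E] [SMulCommClass ℝ 𝕜 E] [CompleteSpace E]

/-- The integral equation `h = ι w + ∫ N(v, h)` has a solution depending analytically on `(v, w)`,
by the implicit function theorem in the Banach space of continuous curves: since `N` vanishes for
`v = 0`, the derivative of the equation with respect to `h` at the origin is the identity. -/
theorem exists_analyticAt_solution_integral_equation [CompleteSpace V] [CompleteSpace W]
    {N : C(unitInterval, V × E) → C(unitInterval, E)} (hN : AnalyticAt 𝕜 N 0)
    (hN0 : ∀ᶠ k in 𝓝 (0 : C(unitInterval, E)), N (prodConst 𝕜 V E (0, k)) = 0) (ι : W →L[𝕜] E) :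
    ∃ h : V × W → C(unitInterval, E), AnalyticAt 𝕜 h 0 ∧ h 0 = 0 ∧
      ∀ᶠ p in 𝓝 (0 : V × W),
        h p = constCurve 𝕜 E (ι p.2) + primitive 𝕜 (N (prodConst 𝕜 V E (p.1, h p))) := by
  let B : (V × W) × C(unitInterval, E) →L[𝕜] C(unitInterval, V × E) :=
    prodConst 𝕜 V E ∘L (((ContinuousLinearMap.fst 𝕜 V W) ∘L
      ContinuousLinearMap.fst 𝕜 (V × W) C(unitInterval, E)).prod
        (ContinuousLinearMap.snd 𝕜 (V × W) C(unitInterval, E)))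
  let L : (V × W) × C(unitInterval, E) →L[𝕜] C(unitInterval, E) :=
    ContinuousLinearMap.snd 𝕜 (V × W) C(unitInterval, E) -
      constCurve 𝕜 E ∘L ι ∘L ContinuousLinearMap.snd 𝕜 V W ∘L
        ContinuousLinearMap.fst 𝕜 (V × W) C(unitInterval, E)
  let Φ : (V × W) × C(unitInterval, E) → C(unitInterval, E) :=
    fun q => L q - primitive 𝕜 (N (B q))
  have hB0 : B 0 = 0 := map_zero B
  have hNB : AnalyticAt 𝕜 N (B 0) := by rwa [hB0]
  have hΦ : ContDiffAt 𝕜 ω Φ 0 := by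
    have h1 : ContDiffAt 𝕜 ω (fun q => N (B q)) 0 := hNB.contDiffAt.comp 0 B.contDiff.contDiffAt
    exact L.contDiff.contDiffAt.sub ((primitive 𝕜 (E := E)).contDiff.contDiffAt.comp 0 h1)
  have hN00 : N 0 = 0 := by
    have := hN0.self_of_nhds
    rwa [show ((0 : V), (0 : C(unitInterval, E))) = 0 from rfl, map_zero] at this
  have hΦ0 : Φ 0 = 0 := by simp [Φ, hB0, hN00]
  have hDN : ∀ k, fderiv 𝕜 N 0 (prodConst 𝕜 V E (0, k)) = 0 := fun k =>
    congrArg (fun A => A k) (fderiv_comp_prodConst_zero hN hN0)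
  have hDΦ : fderiv 𝕜 Φ 0 ∘L .inr 𝕜 (V × W) C(unitInterval, E) =
      ContinuousLinearMap.id 𝕜 C(unitInterval, E) := by
    have h1 : HasFDerivAt Φ (L - primitive 𝕜 ∘L (fderiv 𝕜 N 0 ∘L B)) 0 := by
      have h2 : HasFDerivAt N (fderiv 𝕜 N 0) (B 0) := by
        rw [hB0]; exact hN.differentiableAt.hasFDerivAt
      exact L.hasFDerivAt.sub ((primitive 𝕜 (E := E)).hasFDerivAt.comp 0 (h2.comp 0 B.hasFDerivAt))
    rw [h1.fderiv]
    ext1 k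
    have : B (0, k) = prodConst 𝕜 V E (0, k) := rfl
    simp [L, this, hDN]
  have hinv : (fderiv 𝕜 Φ 0 ∘L .inr 𝕜 (V × W) C(unitInterval, E)).IsInvertible := by
    rw [hDΦ]
    exact ⟨ContinuousLinearEquiv.refl 𝕜 _, rfl⟩
  have hω : (ω : ℕ∞ω) ≠ 0 := by simp
  have h1 := hΦ.contDiffAt_implicitFunction hω hinv
  have h2 := hΦ.implicitFunction_apply_self hω hinv
  have h3 := hΦ.eventually_apply_implicitFunction hω hinv
  refine ⟨hΦ.implicitFunction hω hinv, h1.analyticAt, h2, ?_⟩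
  filter_upwards [h3] with p hp
  rw [hΦ0] at hp
  have hp' : hΦ.implicitFunction hω hinv p - constCurve 𝕜 E (ι p.2) -
      primitive 𝕜 (N (prodConst 𝕜 V E (p.1, hΦ.implicitFunction hω hinv p))) = 0 := hp
  rw [sub_sub] at hp'
  exact sub_eq_zero.1 hp'

/-- Along a solution `x = x₀ + h` of `x' = Y x v`, if the vector fields `Y · v` and `Y · a` commute,
the curve `ζ σ = σ Y (x σ) a` solves the equation linearised in the direction `a` of `v`, that is
`ζ' = Y x a + (DY x ζ) v` with `ζ 0 = 0`, in integrated form. -/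
lemma smul_eq_primitive_of_commute {Y : E → V →L[𝕜] E} {x₀ e : E} {v a : V}
    {h g ζ G : C(unitInterval, E)} (hh : h = constCurve 𝕜 E e + primitive 𝕜 g)
    (hg : ∀ σ, g σ = Y (x₀ + h σ) v) (hY : ∀ σ, DifferentiableAt 𝕜 Y (x₀ + h σ))
    (hcomm : ∀ σ, fderiv 𝕜 Y (x₀ + h σ) (Y (x₀ + h σ) v) a =
      fderiv 𝕜 Y (x₀ + h σ) (Y (x₀ + h σ) a) v)
    (hζ : ∀ σ, ζ σ = (σ : ℝ) • Y (x₀ + h σ) a)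
    (hG : ∀ σ : unitInterval, G σ = Y (x₀ + h σ) a + fderiv 𝕜 Y (x₀ + h σ) (ζ σ) v)
    [IsScalarTower ℝ 𝕜 E] : ζ = primitive 𝕜 G := by
  let c : ℝ → E := fun τ => x₀ + (e + ∫ ρ in (0 : ℝ)..τ, IccExtend zero_le_one g ρ)
  have hc : ∀ σ : unitInterval, c σ = x₀ + h σ := by
    intro σ
    conv_rhs => rw [hh]
    rfl
  have hgc : Continuous (IccExtend zero_le_one g) := g.continuous.Icc_extend' (h := zero_le_one)
  have hdc : ∀ σ : unitInterval, HasDerivAt c (Y (x₀ + h σ) v) σ := by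
    intro σ
    have h1 := intervalIntegral.integral_hasDerivAt_right (hgc.intervalIntegrable 0 σ)
      (hgc.stronglyMeasurableAtFilter _ _) hgc.continuousAt
    rw [IccExtend_of_mem _ _ σ.2, hg] at h1
    exact (h1.const_add e).const_add x₀
  refine eq_primitive (z := fun τ => τ • Y (c τ) a) (by simp) (fun σ => by rw [hζ, hc]) ?_
  intro σ
  have h1 : HasFDerivAt (fun x => Y x a)
      ((ContinuousLinearMap.apply 𝕜 E a) ∘L fderiv 𝕜 Y (x₀ + h σ)) (c σ) := by
    rw [hc]
    exact (ContinuousLinearMap.apply 𝕜 E a).hasFDerivAt.comp _ (hY σ).hasFDerivAt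
  have h2 := (h1.restrictScalars ℝ).comp_hasDerivAt (σ : ℝ) (hdc σ)
  have h3 := (hasDerivAt_id (σ : ℝ)).smul h2
  refine h3.congr_deriv ?_
  simp [hG, hζ, hcomm, hc, add_comm]

end Flow

/-! ### Straightening commuting vector fields -/

section Rectification

variable {𝕜 V W E : Type*} [RCLike 𝕜] [NormedAddCommGroup V] [NormedSpace 𝕜 V]
  [NormedAddCommGroup W] [NormedSpace 𝕜 W] [NormedAddCommGroup E] [NormedSpace 𝕜 E]

/-- A property holding near `x₀` holds along every curve uniformly close to `x₀`. -/
lemma eventually_forall_apply {K : Type*} [TopologicalSpace K] [CompactSpace K] {x₀ : E}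
    {p : E → Prop} (hp : ∀ᶠ x in 𝓝 x₀, p x) :
    ∀ᶠ k in 𝓝 (0 : C(K, E)), ∀ σ, p (x₀ + k σ) := by
  obtain ⟨ε, hε, h⟩ := Metric.eventually_nhds_iff.1 hp
  filter_upwards [Metric.ball_mem_nhds (0 : C(K, E)) hε] with k hk σ
  refine h ?_
  rw [dist_self_add_left]
  exact (k.norm_coe_le_norm σ).trans_lt (by simpa using hk)

lemma hasFDerivAt_apply_fst {Y : E → V →L[𝕜] E} {v : V} {x : E} (hY : DifferentiableAt 𝕜 Y x) :
    HasFDerivAt (fun q : V × E => Y q.2 q.1)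
      ((Y x) ∘L .fst 𝕜 V E + (fderiv 𝕜 Y x).flip v ∘L .snd 𝕜 V E) (v, x) := by
  have h1 : HasFDerivAt (fun q : V × E => Y q.2) (fderiv 𝕜 Y x ∘L .snd 𝕜 V E) (v, x) :=
    HasFDerivAt.comp (v, x) (g := Y) hY.hasFDerivAt hasFDerivAt_snd
  refine (h1.clm_apply hasFDerivAt_fst).congr_fderiv ?_
  ext q <;> simp

variable [NormedSpace ℝ E] [IsScalarTower ℝ 𝕜 E] [SMulCommClass ℝ 𝕜 E] [CompleteSpace E]

/-- Commuting analytic vector fields are rectified analytically: flowing from `x₀ + ι w` along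
`x ↦ Y x v` for unit time gives a map `ψ (v, w)` carrying the coordinate fields `∂/∂v` to the given
ones. -/
theorem exists_analyticAt_flow [CompleteSpace V] [CompleteSpace W] {Y : E → V →L[𝕜] E} {x₀ : E}
    (hY : AnalyticAt 𝕜 Y x₀)
    (hcomm : ∀ᶠ x in 𝓝 x₀, ∀ a b, fderiv 𝕜 Y x (Y x a) b = fderiv 𝕜 Y x (Y x b) a)
    (ι : W →L[𝕜] E) :
    ∃ ψ : V × W → E, AnalyticAt 𝕜 ψ 0 ∧ (∀ᶠ w in 𝓝 (0 : W), ψ (0, w) = x₀ + ι w) ∧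
      ∀ᶠ p in 𝓝 (0 : V × W), ∀ a, fderiv 𝕜 ψ p (a, 0) = Y (ψ p) a := by
  have hf : AnalyticAt 𝕜 (fun q : V × E => Y q.2 q.1) (0, x₀) := by
    have h1 : ContDiffAt 𝕜 ω (fun q : V × E => Y q.2) (0, x₀) :=
      ContDiffAt.comp (0, x₀) (g := Y) hY.contDiffAt contDiffAt_snd
    exact (h1.clm_apply contDiffAt_fst).analyticAt
  obtain ⟨N, hN, hNf⟩ := exists_analyticAt_superposition hf unitInterval
  let J : C(unitInterval, E) →L[𝕜] C(unitInterval, V × E) :=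
    prodConst 𝕜 V E ∘L ContinuousLinearMap.inr 𝕜 V C(unitInterval, E)
  have hJ : Tendsto J (𝓝 0) (𝓝 0) := by simpa using J.continuous.tendsto 0
  have hN0 : ∀ᶠ k in 𝓝 (0 : C(unitInterval, E)), N (prodConst 𝕜 V E (0, k)) = 0 := by
    filter_upwards [hJ.eventually hNf] with k hk
    ext σ
    have := hk σ
    simpa [J] using this
  obtain ⟨h, hh, hh0, hfix⟩ := exists_analyticAt_solution_integral_equation hN hN0 ι
  let κ : V × W → C(unitInterval, V × E) := fun p => prodConst 𝕜 V E (p.1, h p)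
  have hκ0 : κ 0 = 0 := by
    simp only [κ, hh0]
    exact map_zero (prodConst 𝕜 V E)
  have hhc : Tendsto h (𝓝 0) (𝓝 0) := by simpa [hh0] using hh.continuousAt.tendsto
  have hκ : Tendsto κ (𝓝 0) (𝓝 0) := by
    have h1 : ContinuousAt κ 0 := (prodConst 𝕜 V E).continuous.continuousAt.comp
      (continuousAt_fst.prodMk hh.continuousAt)
    simpa [ContinuousAt, hκ0] using h1
  -- For small parameters the linearised equation is a contraction, so its solution is unique.
  have hT : ∀ᶠ p in 𝓝 (0 : V × W), ‖primitive 𝕜 ∘L (fderiv 𝕜 N (κ p) ∘L J)‖ < 1 := by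
    have h1 : ContinuousAt (fun p => primitive 𝕜 ∘L (fderiv 𝕜 N (κ p) ∘L J)) 0 := by
      have h2 : ContinuousAt (fun p => fderiv 𝕜 N (κ p)) 0 := by
        have h3 : ContinuousAt (fderiv 𝕜 N) (κ 0) := by
          rw [hκ0]; exact hN.fderiv.continuousAt
        exact h3.comp (by simpa [ContinuousAt, hκ0] using hκ)
      exact continuousAt_const.clm_comp (h2.clm_comp continuousAt_const)
    have h0 : primitive 𝕜 ∘L (fderiv 𝕜 N (κ 0) ∘L J) = 0 := by
      rw [hκ0, fderiv_comp_prodConst_zero hN hN0, ContinuousLinearMap.comp_zero]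
    have h2 : ContinuousAt (fun p => ‖primitive 𝕜 ∘L (fderiv 𝕜 N (κ p) ∘L J)‖) 0 := by
      refine ContinuousAt.comp (continuous_norm
        (E := C(unitInterval, E) →L[𝕜] C(unitInterval, E))).continuousAt ?_
      exact h1
    refine h2.eventually_lt_const ?_
    exact (congrArg norm h0).trans_lt (ContinuousLinearMap.opNorm_zero.trans_lt one_pos)
  let ev : C(unitInterval, E) →L[𝕜] E := ContinuousMap.evalCLM 𝕜 (1 : unitInterval)
  refine ⟨fun p => x₀ + ev (h p), ?_, ?_, ?_⟩
  · exact analyticAt_const.add ((ev.analyticAt _).comp hh)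
  · have hi : Tendsto (fun w : W => ((0 : V), w)) (𝓝 0) (𝓝 0) :=
      (by fun_prop : Continuous fun w : W => ((0 : V), w)).tendsto' _ _ rfl
    filter_upwards [hi.eventually hfix, hi.eventually (hhc.eventually hN0)] with w hw1 hw2
    rw [hw1]
    simp only [hw2, map_zero]
    simp [ev]
  · have hYc : ∀ᶠ x in 𝓝 x₀, DifferentiableAt 𝕜 Y x ∧
        ∀ a b, fderiv 𝕜 Y x (Y x a) b = fderiv 𝕜 Y x (Y x b) a :=
      (hY.eventually_analyticAt.mono fun x hx => hx.differentiableAt).and hcomm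
    filter_upwards [hfix.eventually_nhds, hh.eventually_analyticAt,
      hκ.eventually hN.eventually_analyticAt, hκ.eventually hNf.eventually_nhds, hT,
      hhc.eventually (eventually_forall_apply hYc)] with p hp1 hp2 hp3 hp4 hp5 hp6 a
    have hdh := hp2.differentiableAt.hasFDerivAt
    have hdκ : HasFDerivAt κ (prodConst 𝕜 V E ∘L (.prod (.fst 𝕜 V W) (fderiv 𝕜 h p))) p :=
      (prodConst 𝕜 V E).hasFDerivAt.comp p (hasFDerivAt_fst.prodMk hdh)
    have hd1 : HasFDerivAt
        (fun p => constCurve 𝕜 E (ι p.2) + primitive 𝕜 (N (κ p))) _ p :=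
      (((constCurve 𝕜 E).hasFDerivAt.comp p (ι.hasFDerivAt.comp p hasFDerivAt_snd))).add
        ((primitive 𝕜 (E := E)).hasFDerivAt.comp p (hp3.differentiableAt.hasFDerivAt.comp p hdκ))
    have hd2 := (hd1.congr_of_eventuallyEq hp1).unique hdh
    -- Both `η`, the derivative of the solution in the direction `a` of `v`, and
    -- `ζ σ = σ Y (x σ) a` are fixed points of the linearised integral equation.
    set η := fderiv 𝕜 h p (a, 0) with hη
    have hη1 : η = primitive 𝕜 (fderiv 𝕜 N (κ p) (prodConst 𝕜 V E (a, η))) := by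
      have := congrArg (fun A => A (a, (0 : W))) hd2
      rw [hη, ← this]
      conv_rhs => rw [hd2]
      simp
    have hYcont : Continuous fun σ : unitInterval => (σ : ℝ) • Y (x₀ + h p σ) a := by
      refine continuous_subtype_val.smul (Continuous.clm_apply ?_ continuous_const)
      refine continuous_iff_continuousAt.2 fun σ => ?_
      exact ContinuousAt.comp (g := Y) (hp6 σ).1.continuousAt (by fun_prop)
    let ζ : C(unitInterval, E) := ⟨_, hYcont⟩
    have hκσ : ∀ σ, ((0 : V), x₀) + κ p σ = (p.1, x₀ + h p σ) := by
      intro σ; simp [κ]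
    have hζ1 : ζ = primitive 𝕜 (fderiv 𝕜 N (κ p) (prodConst 𝕜 V E (a, ζ))) := by
      refine smul_eq_primitive_of_commute (x₀ := x₀) (v := p.1) (a := a) hp1.self_of_nhds ?_
        (fun σ => (hp6 σ).1) (fun σ => (hp6 σ).2 _ _) (fun σ => rfl) ?_
      · intro σ
        have := hp4.self_of_nhds σ
        rw [hκσ] at this
        exact this
      · intro σ
        have hfd := hasFDerivAt_apply_fst (v := p.1) (hp6 σ).1
        rw [fderiv_superposition hp3.differentiableAt hp4 σ
          (by rw [hκσ]; exact hfd.differentiableAt), hκσ, hfd.fderiv]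
        simp
    have hζη : ζ = η := by
      let T := primitive 𝕜 ∘L (fderiv 𝕜 N (κ p) ∘L J)
      have h1 : ζ - η = T (ζ - η) := by
        conv_lhs => rw [hζ1, hη1, ← map_sub, ← map_sub, ← map_sub]
        simp [T, J]
      by_contra hne
      have h2 : 0 < ‖ζ - η‖ := norm_pos_iff.2 (sub_ne_zero.2 hne)
      have h3 : ‖ζ - η‖ < ‖ζ - η‖ := calc
        ‖ζ - η‖ = ‖T (ζ - η)‖ := by rw [← h1]
        _ ≤ ‖T‖ * ‖ζ - η‖ := T.le_opNorm _
        _ < 1 * ‖ζ - η‖ := by gcongr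
        _ = ‖ζ - η‖ := one_mul _
      exact lt_irrefl _ h3
    have hψ : HasFDerivAt (fun p => x₀ + ev (h p)) (ev ∘L fderiv 𝕜 h p) p :=
      (ev.hasFDerivAt.comp p hdh).const_add x₀
    rw [hψ.fderiv]
    change ev η = _
    rw [← hζη]
    simp [ev, ζ]

/-- The analytic Frobenius theorem for commuting vector fields: if the values at `x₀` of the fields
`Y · v` and the image of `ι` decompose `E`, there is a submersion `F` near `x₀` constant along the
fields, namely the second component of the inverse of the straightening map `ψ`. -/
theorem exists_analyticAt_submersion [CompleteSpace V] [CompleteSpace W]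
    {Y : E → V →L[𝕜] E} {x₀ : E} (hY : AnalyticAt 𝕜 Y x₀)
    (hcomm : ∀ᶠ x in 𝓝 x₀, ∀ a b, fderiv 𝕜 Y x (Y x a) b = fderiv 𝕜 Y x (Y x b) a)
    (ι : W →L[𝕜] E) (e : (V × W) ≃L[𝕜] E) (he : ∀ v w, e (v, w) = Y x₀ v + ι w) :
    ∃ F : E → W, AnalyticAt 𝕜 F x₀ ∧ ∀ᶠ x in 𝓝 x₀,
      (∀ v, fderiv 𝕜 F x (Y x v) = 0) ∧ Function.Surjective (fderiv 𝕜 F x) ∧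
        Function.Injective (Y x) := by
  obtain ⟨ψ, hψ, hψ0, hψY⟩ := exists_analyticAt_flow hY hcomm ι
  have hx : ψ 0 = x₀ := by
    have : ψ (0, 0) = x₀ := by simpa using hψ0.self_of_nhds
    exact this
  have hd : HasFDerivAt ψ (e : V × W →L[𝕜] E) 0 := by
    have h1 := hψ.differentiableAt.hasFDerivAt
    have h2 : HasFDerivAt (fun w : W => ψ (0, w)) (fderiv 𝕜 ψ 0 ∘L .inr 𝕜 V W) 0 :=
      HasFDerivAt.comp (0 : W) (g := ψ) (f := fun w => (0, w)) h1 (hasFDerivAt_prodMk_right 0 0)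
    have h3 := h2.unique ((ι.hasFDerivAt.const_add x₀).congr_of_eventuallyEq hψ0)
    refine h1.congr_fderiv ?_
    refine ContinuousLinearMap.ext fun ⟨v, w⟩ => ?_
    have h4 := hψY.self_of_nhds v
    have h5 := congrArg (fun A => A w) h3
    simp only [ContinuousLinearMap.comp_apply, ContinuousLinearMap.inr_apply] at h5
    rw [hx] at h4
    calc fderiv 𝕜 ψ 0 (v, w) = fderiv 𝕜 ψ 0 (v, 0) + fderiv 𝕜 ψ 0 (0, w) := by
          rw [← map_add]; simp
      _ = e (v, w) := by rw [h4, h5, he]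
  have hω : (ω : ℕ∞ω) ≠ 0 := by simp
  have hc : ContDiffAt 𝕜 ω ψ 0 := hψ.contDiffAt
  let φ := hc.localInverse hd hω
  have hφ : AnalyticAt 𝕜 φ x₀ := by
    have := (hc.to_localInverse hd hω).analyticAt
    rwa [hx] at this
  have hφ0 : φ x₀ = 0 := by
    have := hc.localInverse_apply_image hd hω
    rwa [hx] at this
  have hst := hc.hasStrictFDerivAt' hd hω
  have hr : ∀ᶠ x in 𝓝 x₀, ψ (φ x) = x := by
    have := hst.eventually_right_inverse
    rwa [hx] at this
  have hl : ∀ᶠ p in 𝓝 0, φ (ψ p) = p := hst.eventually_left_inverse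
  have hφt : Tendsto φ (𝓝 x₀) (𝓝 0) := by simpa [hφ0] using hφ.continuousAt.tendsto
  refine ⟨fun x => (φ x).2, analyticAt_snd.comp hφ, ?_⟩
  filter_upwards [hφ.eventually_analyticAt, hr, hφt.eventually hl.eventually_nhds,
    hφt.eventually hψ.eventually_analyticAt, hφt.eventually hψY] with x hx1 hx2 hx3 hx4 hx5
  have hdφ := hx1.differentiableAt.hasFDerivAt
  have hdψ := hx4.differentiableAt.hasFDerivAt
  have hcomp : fderiv 𝕜 φ x ∘L fderiv 𝕜 ψ (φ x) = .id 𝕜 (V × W) := by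
    have h1 : HasFDerivAt φ (fderiv 𝕜 φ x) (ψ (φ x)) := by rwa [hx2]
    exact (h1.comp (φ x) hdψ).unique ((hasFDerivAt_id _).congr_of_eventuallyEq hx3)
  have hcomp' : ∀ q, fderiv 𝕜 φ x (fderiv 𝕜 ψ (φ x) q) = q :=
    fun q => congrArg (fun A => A q) hcomp
  have hYφ : ∀ v, fderiv 𝕜 φ x (Y x v) = (v, 0) := by
    intro v
    have := hx5 v
    rw [hx2] at this
    rw [← this, hcomp']
  have hdF : HasFDerivAt (fun x => (φ x).2) (.snd 𝕜 V W ∘L fderiv 𝕜 φ x) x :=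
    hasFDerivAt_snd.comp x hdφ
  refine ⟨fun v => ?_, fun w => ⟨fderiv 𝕜 ψ (φ x) (0, w), ?_⟩, fun v v' hv => ?_⟩
  · simp [hdF.fderiv, hYφ]
  · simp [hdF.fderiv, hcomp']
  · have := hYφ v
    rw [hv, hYφ] at this
    exact (congrArg Prod.fst this).symm

end Rectification

/-! ### The vector fields of the total differential system -/

section System

variable {𝕜 : Type*} [RCLike 𝕜] {s m n : ℕ}

/-- The projection `t ↦ ˢt`. -/
noncomputable def restrictTime (𝕜 : Type*) [RCLike 𝕜] (hs : s ≤ m) :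
    (Fin m → 𝕜) →L[𝕜] (Fin s → 𝕜) :=
  ContinuousLinearMap.pi fun j => ContinuousLinearMap.proj (Fin.castLE hs j)

/-- The extension by zero of `ˢt` to a vector of `𝕜ᵐ`. -/
noncomputable def extendTime (𝕜 : Type*) [RCLike 𝕜] (s m : ℕ) : (Fin s → 𝕜) →L[𝕜] (Fin m → 𝕜) :=
  ContinuousLinearMap.pi fun i =>
    if h : i.val < s then ContinuousLinearMap.proj ⟨i.val, h⟩ else 0

/-- The vector fields on `𝕜ˢ × 𝕜ⁿ` whose annihilation characterises `s`-nonautonomous first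
integrals: at `q` the time increment `dt` is sent to `(ˢdt, X(q) dt)`. -/
noncomputable def field (hs : s ≤ m) (X : (Fin s → 𝕜) × (Fin n → 𝕜) → Matrix (Fin n) (Fin m) 𝕜)
    (q : (Fin s → 𝕜) × (Fin n → 𝕜)) : (Fin m → 𝕜) →L[𝕜] (Fin s → 𝕜) × (Fin n → 𝕜) :=
  (restrictTime 𝕜 hs).prod (LinearMap.toContinuousLinearMap (X q).mulVecLin)

@[simp]
lemma restrictTime_apply (hs : s ≤ m) (t : Fin m → 𝕜) (j : Fin s) :
    restrictTime 𝕜 hs t j = t (Fin.castLE hs j) := rfl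

lemma field_apply (hs : s ≤ m) (X : (Fin s → 𝕜) × (Fin n → 𝕜) → Matrix (Fin n) (Fin m) 𝕜)
    (q : (Fin s → 𝕜) × (Fin n → 𝕜)) (a : Fin m → 𝕜) :
    field hs X q a = (restrictTime 𝕜 hs a, (X q).mulVec a) := rfl

lemma restrictTime_extendTime (hs : s ≤ m) (t : Fin s → 𝕜) :
    restrictTime 𝕜 hs (extendTime 𝕜 s m t) = t := by
  ext j
  simp [extendTime]

lemma proj_eq (hs : s ≤ m) (p : (Fin m → 𝕜) × (Fin n → 𝕜)) :
    proj hs p = (restrictTime 𝕜 hs p.1, p.2) := rfl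

lemma proj_extendTime (hs : s ≤ m) (q : (Fin s → 𝕜) × (Fin n → 𝕜)) :
    proj hs (extendTime 𝕜 s m q.1, q.2) = q := by
  rw [proj_eq, restrictTime_extendTime]

lemma analyticAt_field (hs : s ≤ m)
    {X : (Fin s → 𝕜) × (Fin n → 𝕜) → Matrix (Fin n) (Fin m) 𝕜} {q : (Fin s → 𝕜) × (Fin n → 𝕜)}
    (hX : ∀ i j, AnalyticAt 𝕜 (fun q => X q i j) q) : AnalyticAt 𝕜 (field hs X) q := by
  let ℓ : (Fin n → Fin m → 𝕜) →ₗ[𝕜] ((Fin m → 𝕜) →L[𝕜] (Fin s → 𝕜) × (Fin n → 𝕜)) :=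
    (LinearMap.toContinuousLinearMap : ((Fin m → 𝕜) →ₗ[𝕜] (Fin s → 𝕜) × (Fin n → 𝕜)) ≃ₗ[𝕜]
      ((Fin m → 𝕜) →L[𝕜] (Fin s → 𝕜) × (Fin n → 𝕜))).toLinearMap ∘ₗ
      (LinearMap.compRight 𝕜 (LinearMap.inr 𝕜 (Fin s → 𝕜) (Fin n → 𝕜))) ∘ₗ
      (Matrix.toLin' : Matrix (Fin n) (Fin m) 𝕜 ≃ₗ[𝕜] _).toLinearMap ∘ₗ
      (Matrix.ofLinearEquiv 𝕜 : (Fin n → Fin m → 𝕜) ≃ₗ[𝕜] _).toLinearMap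
  have h1 : AnalyticAt 𝕜 (fun q i j => X q i j) q :=
    AnalyticAt.pi fun i => AnalyticAt.pi fun j => hX i j
  have h2 : field hs X = fun q => ((restrictTime 𝕜 hs).prod 0) +
      LinearMap.toContinuousLinearMap ℓ (fun i j => X q i j) := by
    funext q
    refine ContinuousLinearMap.ext fun a => ?_
    have : ℓ (fun i j => X q i j) a = (0, (X q).mulVec a) := rfl
    simp [field_apply, this]
  rw [h2]
  exact analyticAt_const.add
    (((LinearMap.toContinuousLinearMap ℓ).analyticAt _).comp
      (g := LinearMap.toContinuousLinearMap ℓ) h1)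

/-- Complete solvability forces the fields to commute: through every point passes an integral
manifold `c` with `Dc = Y ∘ c`, and the second derivative of `c` is symmetric. -/
lemma fderiv_field_comm (hs : s ≤ m) {D : Set ((Fin s → 𝕜) × (Fin n → 𝕜))}
    {X : (Fin s → 𝕜) × (Fin n → 𝕜) → Matrix (Fin n) (Fin m) 𝕜}
    (hsolv : CompletelySolvableOn (fun p => X (proj hs p)) (proj hs ⁻¹' D))
    {q : (Fin s → 𝕜) × (Fin n → 𝕜)} (hq : q ∈ D) (hX : DifferentiableAt 𝕜 (field hs X) q)
    (a b : Fin m → 𝕜) :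
    fderiv 𝕜 (field hs X) q (field hs X q a) b = fderiv 𝕜 (field hs X) q (field hs X q b) a := by
  have hqp := proj_extendTime hs q
  obtain ⟨⟨T, x, hT, ht, hx, hx0⟩, -⟩ := hsolv (extendTime 𝕜 s m q.1) q.2
    (by rw [mem_preimage, hqp]; exact hq)
  let c : (Fin m → 𝕜) → (Fin s → 𝕜) × (Fin n → 𝕜) := fun t => proj hs (t, x t)
  have hc : ∀ t ∈ T, HasFDerivAt c (field hs X (c t)) t := fun t ht =>
    (restrictTime 𝕜 hs).hasFDerivAt.prodMk (hx t ht).2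
  have hc0 : c (extendTime 𝕜 s m q.1) = q := by
    simp only [c, hx0, hqp]
  have h1 : HasFDerivAt (fun t => field hs X (c t)) (fderiv 𝕜 (field hs X) q ∘L field hs X q)
      (extendTime 𝕜 s m q.1) := by
    have h2 := hc _ ht
    have h3 : HasFDerivAt (field hs X) (fderiv 𝕜 (field hs X) q) (c (extendTime 𝕜 s m q.1)) := by
      rw [hc0]; exact hX.hasFDerivAt
    have h4 := h3.comp _ h2
    rwa [hc0] at h4
  exact second_derivative_symmetric_of_eventually
    (eventually_of_mem (hT.mem_nhds ht) hc) h1 a b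

/-- First integrals in terms of `(ˢt, x)` alone: the differential kills the fields. As
`(t, x) ↦ (ˢt, x)` has a linear section, analyticity descends to functions of `(ˢt, x)`. -/
lemma isNonautonomousFirstIntegralOn_iff (hs : s ≤ m)
    {X : (Fin s → 𝕜) × (Fin n → 𝕜) → Matrix (Fin n) (Fin m) 𝕜}
    {U : Set ((Fin s → 𝕜) × (Fin n → 𝕜))} {F : (Fin s → 𝕜) × (Fin n → 𝕜) → 𝕜} :
    IsNonautonomousFirstIntegralOn hs X U F ↔
      AnalyticOnNhd 𝕜 F U ∧ ∀ q ∈ U, ∀ a, fderiv 𝕜 F q (field hs X q a) = 0 := by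
  let π : (Fin m → 𝕜) × (Fin n → 𝕜) →L[𝕜] (Fin s → 𝕜) × (Fin n → 𝕜) :=
    (restrictTime 𝕜 hs).prodMap (.id 𝕜 (Fin n → 𝕜))
  let ε : (Fin s → 𝕜) × (Fin n → 𝕜) →L[𝕜] (Fin m → 𝕜) × (Fin n → 𝕜) :=
    (extendTime 𝕜 s m).prodMap (.id 𝕜 (Fin n → 𝕜))
  have hπε : ∀ q, proj hs (ε q) = q := proj_extendTime hs
  have han : AnalyticOnNhd 𝕜 (fun p => F (proj hs p)) (proj hs ⁻¹' U) ↔ AnalyticOnNhd 𝕜 F U := by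
    constructor
    · intro h q hq
      have h1 := h (ε q) (by rw [mem_preimage, hπε]; exact hq)
      have h2 := h1.comp (ε.analyticAt q)
      simpa [Function.comp_def, hπε] using h2
    · intro h p hp
      exact AnalyticAt.comp (g := F) (f := π) (h _ hp) (π.analyticAt p)
  have hop : ∀ p, DifferentiableAt 𝕜 F (proj hs p) → ∀ j,
      operator (fun p => X (proj hs p)) j (fun p => F (proj hs p)) p =
        fderiv 𝕜 F (proj hs p) (field hs X (proj hs p) (Pi.single j 1)) := by
    intro p hF j
    have h1 : HasFDerivAt (fun p => F (proj hs p)) (fderiv 𝕜 F (proj hs p) ∘L π) p :=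
      HasFDerivAt.comp (g := F) (f := π) p hF.hasFDerivAt π.hasFDerivAt
    have h2 : field hs X (proj hs p) (Pi.single j 1) =
        π (Pi.single j 1, 0) + ∑ i, X (proj hs p) i j • π (0, Pi.single i 1) := by
      ext i
      · simp [field_apply, π, Prod.fst_sum]
      · simp [field_apply, π, Prod.snd_sum, Pi.single_apply]
    rw [operator, h1.fderiv, h2]
    simp only [map_add, map_sum, map_smul, smul_eq_mul, ContinuousLinearMap.comp_apply]
  rw [IsNonautonomousFirstIntegralOn, IsFirstIntegralOn, han]
  refine and_congr_right fun hF => ⟨fun h q hq a => ?_, fun h p hp j => ?_⟩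
  · have h1 : ∀ j, fderiv 𝕜 F q (field hs X q (Pi.single j 1)) = 0 := by
      intro j
      have h2 := h (ε q) (by rw [mem_preimage, hπε]; exact hq) j
      rwa [hop _ (by rw [hπε]; exact (hF q hq).differentiableAt), hπε] at h2
    rw [pi_eq_sum_univ' a]
    simp [map_sum, h1]
  · rw [hop p (hF _ hp).differentiableAt]
    exact h _ hp _

lemma rank_jacobi {k : ℕ} (F : Fin k → (Fin s → 𝕜) × (Fin n → 𝕜) → 𝕜)
    (q : (Fin s → 𝕜) × (Fin n → 𝕜)) :
    (jacobi F q).rank = Module.finrank 𝕜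
      (LinearMap.range (ContinuousLinearMap.pi fun l => fderiv 𝕜 (F l) q).toLinearMap) := by
  let e := LinearEquiv.sumArrowLequivProdArrow (Fin s) (Fin n) 𝕜 𝕜
  have h1 : (jacobi F q).mulVecLin =
      (ContinuousLinearMap.pi fun l => fderiv 𝕜 (F l) q).toLinearMap ∘ₗ e.toLinearMap := by
    refine LinearMap.pi_ext' fun j => LinearMap.ext_ring ?_
    ext l
    rcases j with j | j
    · have : e (Pi.single (Sum.inl j) 1) = (Pi.single j 1, 0) := by
        ext i
        · simp [e, Pi.single_apply]
        · simp [e]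
      simp [this, jacobi]
    · have : e (Pi.single (Sum.inr j) 1) = (0, Pi.single j 1) := by
        ext i
        · simp [e]
        · simp [e, Pi.single_apply]
      simp [this, jacobi]
  rw [Matrix.rank, h1, LinearMap.range_comp_of_range_eq_top _ e.range]

/-- The kernel of `field hs X q` is that of `ˢX(q)`, extended by zero, so `field hs X q` has rank
`s + rank ˢX(q)`. -/
lemma finrank_ker_field (hs : s ≤ m)
    (X : (Fin s → 𝕜) × (Fin n → 𝕜) → Matrix (Fin n) (Fin m) 𝕜) (q : (Fin s → 𝕜) × (Fin n → 𝕜)) :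
    s + (deleteColumns s (X q)).rank +
      Module.finrank 𝕜 (LinearMap.ker (field hs X q).toLinearMap) = m := by
  let ε : ({j : Fin m // s ≤ j.val} → 𝕜) →ₗ[𝕜] (Fin m → 𝕜) :=
    Function.ExtendByZero.linearMap 𝕜 Subtype.val
  have hε : ∀ c (j : {j : Fin m // s ≤ j.val}), ε c j = c j := fun c j =>
    Subtype.val_injective.extend_apply _ _ _
  have hε0 : ∀ c (j : Fin m), ¬ s ≤ j.val → ε c j = 0 := fun c j hj =>
    Function.extend_apply' _ _ _ (by rintro ⟨i, rfl⟩; exact hj i.2)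
  have hinj : Function.Injective ε := fun c d hcd => by
    ext j
    rw [← hε c, hcd, hε]
  have hmul : ∀ c, (X q).mulVec (ε c) = (deleteColumns s (X q)).mulVec c := by
    intro c
    ext i
    simp only [Matrix.mulVec, dotProduct, deleteColumns, Matrix.submatrix_apply, id]
    rw [← Finset.sum_subset (Finset.subset_univ ((Finset.univ : Finset (Fin m)).filter
      fun j => s ≤ j.val))]
    · refine (Finset.sum_subtype (F := inferInstance) (p := fun j : Fin m => s ≤ j.val) _
        (by simp) _).trans ?_
      simp [hε]
    · intro j _ hj
      rw [hε0 c j (by simpa using hj), mul_zero]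
  have hker : LinearMap.ker (field hs X q).toLinearMap =
      (LinearMap.ker (deleteColumns s (X q)).mulVecLin).map ε := by
    ext a
    simp only [LinearMap.mem_ker, Submodule.mem_map, ContinuousLinearMap.coe_coe, field_apply,
      Matrix.mulVecLin_apply, Prod.mk_eq_zero]
    constructor
    · rintro ⟨h1, h2⟩
      have h3 : ε (fun j => a j) = a := by
        ext j
        by_cases hj : s ≤ j.val
        · exact hε _ ⟨j, hj⟩
        · rw [hε0 _ _ hj]
          exact (congrFun h1 ⟨j.val, not_le.1 hj⟩).symm
      exact ⟨_, by rw [← hmul, h3, h2], h3⟩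
    · rintro ⟨c, h1, rfl⟩
      refine ⟨?_, by rw [hmul, h1]⟩
      ext j
      exact hε0 c _ (by simp)
  have h1 := LinearMap.finrank_range_add_finrank_ker (deleteColumns s (X q)).mulVecLin
  have h2 : Fintype.card {j : Fin m // s ≤ j.val} + s = m := by
    have h3 := Fintype.card_subtype_compl (fun j : Fin m => j.val < s)
    have h4 : Fintype.card {j : Fin m // j.val < s} = s := Fintype.card_fin_lt_of_le hs
    simp only [not_lt, Fintype.card_fin, h4] at h3
    rw [h3]; omega
  rw [Module.finrank_fintype_fun_eq_card] at h1
  rw [hker, ← (Submodule.equivMapOfInjective ε hinj _).finrank_eq, Matrix.rank]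
  omega

end System

/-! ### First integrals of systems of constant rank -/

section Frobenius

variable {𝕜 : Type*} [RCLike 𝕜] {s m n : ℕ}

/-- Near every point there is an analytic submersion onto `𝕜^(n - r)` killed by the fields. One
straightens the fields spanned by a complement of the kernel at the base point; as the rank is
constant, they span the range of all the fields nearby. -/
theorem exists_analyticOnNhd_submersion (hs : s ≤ m) {D : Set ((Fin s → 𝕜) × (Fin n → 𝕜))}
    (hD : IsOpen D) {X : (Fin s → 𝕜) × (Fin n → 𝕜) → Matrix (Fin n) (Fin m) 𝕜}
    (hX : ∀ i j, AnalyticOnNhd 𝕜 (fun q => X q i j) D)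
    (hsolv : CompletelySolvableOn (fun p => X (proj hs p)) (proj hs ⁻¹' D))
    {r : ℕ} (hr : ∀ q ∈ D, (deleteColumns s (X q)).rank = r)
    {q₀ : (Fin s → 𝕜) × (Fin n → 𝕜)} (hq₀ : q₀ ∈ D) :
    ∃ F : (Fin s → 𝕜) × (Fin n → 𝕜) → (Fin (n - r) → 𝕜), ∀ᶠ q in 𝓝 q₀, AnalyticAt 𝕜 F q ∧
      (∀ a, fderiv 𝕜 F q (field hs X q a) = 0) ∧ Function.Surjective (fderiv 𝕜 F q) := by
  have hY : ∀ q ∈ D, AnalyticAt 𝕜 (field hs X) q := fun q hq =>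
    analyticAt_field hs fun i j => hX i j q hq
  have hrank : ∀ q ∈ D,
      Module.finrank 𝕜 (LinearMap.range (field hs X q).toLinearMap) = s + r := by
    intro q hq
    have h1 := finrank_ker_field hs X q
    have h2 := LinearMap.finrank_range_add_finrank_ker (field hs X q).toLinearMap
    rw [Module.finrank_fin_fun] at h2
    rw [hr q hq] at h1
    omega
  have hrn : r ≤ n := by
    have := (deleteColumns s (X q₀)).rank_le_card_height
    rwa [hr q₀ hq₀, Fintype.card_fin] at this
  obtain ⟨V, hV⟩ := Submodule.exists_isCompl (LinearMap.ker (field hs X q₀).toLinearMap)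
  obtain ⟨W, hW⟩ := Submodule.exists_isCompl (LinearMap.range (field hs X q₀).toLinearMap)
  have hVr : Module.finrank 𝕜 V = s + r := by
    have h1 := Submodule.finrank_add_eq_of_isCompl hV
    have h2 := LinearMap.finrank_range_add_finrank_ker (field hs X q₀).toLinearMap
    have h3 := hrank q₀ hq₀
    omega
  have hWr : Module.finrank 𝕜 W = n - r := by
    have h1 := Submodule.finrank_add_eq_of_isCompl hW
    rw [hrank q₀ hq₀, Module.finrank_prod, Module.finrank_fin_fun, Module.finrank_fin_fun] at h1
    omega
  let b : (Fin (n - r) → 𝕜) ≃ₗ[𝕜] W := LinearEquiv.ofFinrankEq _ _ (by rw [hWr]; simp)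
  let ι : (Fin (n - r) → 𝕜) →L[𝕜] (Fin s → 𝕜) × (Fin n → 𝕜) :=
    LinearMap.toContinuousLinearMap (W.subtype ∘ₗ b.toLinearMap)
  have hι : ∀ w, ι w = b w := fun w => rfl
  let Y : (Fin s → 𝕜) × (Fin n → 𝕜) → V →L[𝕜] (Fin s → 𝕜) × (Fin n → 𝕜) :=
    fun q => field hs X q ∘L V.subtypeL
  have hYan : ∀ q ∈ D, AnalyticAt 𝕜 Y q := fun q hq =>
    ((hY q hq).contDiffAt (n := ω) |>.clm_comp contDiffAt_const).analyticAt
  have hYd : ∀ q ∈ D, ∀ u v, fderiv 𝕜 Y q u v = fderiv 𝕜 (field hs X) q u v := by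
    intro q hq u v
    have h1 : HasFDerivAt Y _ q := (hY q hq).differentiableAt.hasFDerivAt.clm_comp
      (hasFDerivAt_const V.subtypeL q)
    rw [h1.fderiv]
    simp
  have hcomm : ∀ᶠ q in 𝓝 q₀, ∀ a b, fderiv 𝕜 Y q (Y q a) b = fderiv 𝕜 Y q (Y q b) a := by
    filter_upwards [hD.mem_nhds hq₀] with q hq a b
    rw [hYd q hq, hYd q hq]
    exact fderiv_field_comm hs hsolv hq (hY q hq).differentiableAt a b
  let e₀ : (V × (Fin (n - r) → 𝕜)) →ₗ[𝕜] (Fin s → 𝕜) × (Fin n → 𝕜) :=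
    (Y q₀).toLinearMap.coprod ι.toLinearMap
  have he₀ : Function.Injective e₀ := by
    rw [← LinearMap.ker_eq_bot, LinearMap.ker_eq_bot']
    rintro ⟨v, w⟩ hvw
    have h1 : Y q₀ v + ι w = 0 := hvw
    have h2 : Y q₀ v ∈ LinearMap.range (field hs X q₀).toLinearMap := ⟨v, rfl⟩
    have h3 : Y q₀ v ∈ W := by
      rw [eq_neg_of_add_eq_zero_left h1, hι]
      exact W.neg_mem (b w).2
    have h4 : Y q₀ v = 0 := Submodule.disjoint_def.1 hW.disjoint _ h2 h3
    have h5 : (v : Fin m → 𝕜) = 0 := Submodule.disjoint_def.1 hV.disjoint _ h4 v.2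
    rw [h4, zero_add, hι] at h1
    have h6 : w = 0 := by
      simpa using h1
    exact Prod.ext (Subtype.ext h5) h6
  have hfr : Module.finrank 𝕜 (V × (Fin (n - r) → 𝕜)) =
      Module.finrank 𝕜 ((Fin s → 𝕜) × (Fin n → 𝕜)) := by
    simp only [Module.finrank_prod, Module.finrank_fin_fun, hVr]
    omega
  let e := (LinearEquiv.ofInjectiveOfFinrankEq e₀ he₀ hfr).toContinuousLinearEquiv
  have : CompleteSpace V := FiniteDimensional.complete 𝕜 V
  obtain ⟨F, hF, hFY⟩ := exists_analyticAt_submersion (hYan q₀ hq₀) hcomm ι e (fun v w => rfl)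
  refine ⟨F, ?_⟩
  filter_upwards [hF.eventually_analyticAt, hFY, hD.mem_nhds hq₀] with q hq1 hq2 hq
  refine ⟨hq1, fun a => ?_, hq2.2.1⟩
  have hle : LinearMap.range (Y q).toLinearMap ≤ LinearMap.range (field hs X q).toLinearMap := by
    rintro _ ⟨v, rfl⟩
    exact ⟨v, rfl⟩
  have heq := Submodule.eq_of_le_of_finrank_eq hle (by
    rw [LinearMap.finrank_range_of_inj hq2.2.2, hVr, hrank q hq])
  have ha : field hs X q a ∈ LinearMap.range (Y q).toLinearMap := by
    rw [heq]
    exact ⟨a, rfl⟩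
  obtain ⟨v, hv⟩ := ha
  rw [← hv]
  exact hq2.1 v

/-- The differentials of first integrals annihilate a space of dimension `s + r`, so at most `n - r`
of them are linearly independent. -/
lemma rank_jacobi_add_le (hs : s ≤ m)
    {X : (Fin s → 𝕜) × (Fin n → 𝕜) → Matrix (Fin n) (Fin m) 𝕜} {k : ℕ}
    {F : Fin k → (Fin s → 𝕜) × (Fin n → 𝕜) → 𝕜} {q : (Fin s → 𝕜) × (Fin n → 𝕜)}
    (hF : ∀ l a, fderiv 𝕜 (F l) q (field hs X q a) = 0) :
    (jacobi F q).rank + (deleteColumns s (X q)).rank ≤ n := by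
  rw [rank_jacobi]
  have h1 := LinearMap.finrank_range_add_finrank_ker
    (ContinuousLinearMap.pi fun l => fderiv 𝕜 (F l) q).toLinearMap
  have hle : LinearMap.range (field hs X q).toLinearMap ≤
      LinearMap.ker (ContinuousLinearMap.pi fun l => fderiv 𝕜 (F l) q).toLinearMap := by
    rintro _ ⟨a, rfl⟩
    ext l
    exact hF l a
  have h2 := Submodule.finrank_mono hle
  have h3 := finrank_ker_field hs X q
  have h4 := LinearMap.finrank_range_add_finrank_ker (field hs X q).toLinearMap
  rw [Module.finrank_fin_fun] at h4
  rw [Module.finrank_prod, Module.finrank_fin_fun, Module.finrank_fin_fun] at h1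
  omega

end Frobenius

end TotalDifferential

open TotalDifferential in
theorem theorem1p4 {𝕜 : Type*} [RCLike 𝕜] {s m n : ℕ} (hs : s ≤ m) (_hm : m ≤ n)
    (D : Set ((Fin s → 𝕜) × (Fin n → 𝕜))) (hDo : IsOpen D) (hDc : IsConnected D)
    (X : (Fin s → 𝕜) × (Fin n → 𝕜) → Matrix (Fin n) (Fin m) 𝕜)
    (hX : ∀ i j, AnalyticOnNhd 𝕜 (fun q => X q i j) D)
    (hsolv : TotalDifferential.CompletelySolvableOn
      (fun p => X (TotalDifferential.proj hs p)) (TotalDifferential.proj hs ⁻¹' D))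
    (r : ℕ) (hr : ∀ q ∈ D, (TotalDifferential.deleteColumns s (X q)).rank = r) :
    r ≤ n ∧
    (∀ q ∈ D, ∃ U : Set ((Fin s → 𝕜) × (Fin n → 𝕜)),
      IsOpen U ∧ IsConnected U ∧ q ∈ U ∧ U ⊆ D ∧
      ∃ F : Fin (n - r) → (Fin s → 𝕜) × (Fin n → 𝕜) → 𝕜,
        (∀ l, TotalDifferential.IsNonautonomousFirstIntegralOn hs X U (F l)) ∧
        TotalDifferential.FunctionallyIndependentOn U F ∧
        ∀ u ∈ U, (TotalDifferential.jacobi F u).rank = n - r) ∧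
    (∀ V : Set ((Fin s → 𝕜) × (Fin n → 𝕜)), IsOpen V → V.Nonempty → V ⊆ D →
      ∀ (k : ℕ) (F : Fin k → (Fin s → 𝕜) × (Fin n → 𝕜) → 𝕜),
        (∀ l, TotalDifferential.IsNonautonomousFirstIntegralOn hs X V (F l)) →
        TotalDifferential.FunctionallyIndependentOn V F → k ≤ n - r) := by
  refine ⟨?_, fun q₀ hq₀ => ?_, fun V hV hVn hVD k F hF hind => ?_⟩
  · obtain ⟨q, hq⟩ := hDc.nonempty
    have := (deleteColumns s (X q)).rank_le_card_height
    rwa [hr q hq, Fintype.card_fin] at this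
  · obtain ⟨F, hF⟩ := exists_analyticOnNhd_submersion hs hDo hX hsolv hr hq₀
    obtain ⟨ε, hε, hball⟩ := Metric.mem_nhds_iff.1 (hF.and (hDo.mem_nhds hq₀))
    have hcoord : ∀ u ∈ Metric.ball q₀ ε, ∀ l, HasFDerivAt (fun q => F q l)
        (ContinuousLinearMap.proj l ∘L fderiv 𝕜 F u) u := fun u hu l =>
      (ContinuousLinearMap.proj (R := 𝕜) (φ := fun _ : Fin (n - r) => 𝕜) l).hasFDerivAt.comp u
        (hball hu).1.1.differentiableAt.hasFDerivAt
    have hrk : ∀ u ∈ Metric.ball q₀ ε, (jacobi (fun l q => F q l) u).rank = n - r := by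
      intro u hu
      have h1 : (ContinuousLinearMap.pi fun l => fderiv 𝕜 (fun q => F q l) u) = fderiv 𝕜 F u := by
        refine ContinuousLinearMap.ext fun x => ?_
        ext l
        simp [(hcoord u hu l).fderiv]
      rw [rank_jacobi, h1, LinearMap.range_eq_top.2 (hball hu).1.2.2]
      simp
    refine ⟨Metric.ball q₀ ε, Metric.isOpen_ball, Metric.isConnected_ball hε,
      Metric.mem_ball_self hε, fun u hu => (hball hu).2, fun l q => F q l, fun l => ?_,
      Filter.Eventually.of_forall hrk, hrk⟩
    refine (isNonautonomousFirstIntegralOn_iff hs).2 ⟨fun u hu => ?_, fun u hu a => ?_⟩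
    · exact (analyticAt_pi_iff.1 (hball hu).1.1) l
    · rw [(hcoord u hu l).fderiv, ContinuousLinearMap.comp_apply, (hball hu).1.2.1 a]
      rfl
  · -- A nonempty open set is not null, so the rank is `k` at some point of `V`.
    obtain ⟨q, hqV, hq⟩ : ∃ q ∈ V, (jacobi F q).rank = k := by
      by_contra! hne
      refine (hV.measure_pos Measure.addHaar hVn).ne' (measure_mono_null ?_ (ae_iff.1 hind))
      exact fun q hq h => hne q hq (h hq)
    have h1 := rank_jacobi_add_le hs (X := X) (F := F) (q := q) fun l a =>
      ((isNonautonomousFirstIntegralOn_iff hs).1 (hF l)).2 q hqV a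
    rw [hq, hr q (hVD hqV)] at h1
    omega
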